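/- Let $\beta\ge 0$ and let $\mathbb Q^{(\beta)}=(\mathbb Q^{(\beta)}_t)_{t\ge 0}$ be the transition semigroup of the linear birth–death process on $\mathbb Z_+=\{0,1,2,\dots\}$ with generator $$\mathbb G_\beta g(n)=(n+\beta)\,\bigl(g(n+1)-g(n)\bigr)+n\,\bigl(g(n-1)-g(n)\bigr).$$ For a function $g$ on $\mathbb Z_+$ and $x\ge 0$ put $\Lambda g(x)=\mathbb E[g(\mathrm{Pois}(x))]$, where $\mathrm{Pois}(x)$ is a Poisson variable with parameter $x$; for a function $f$ on $\mathbb R_+$ put $d_\sigma f(x)=f(\sigma x)$. For $\sigma>0$ let $$\mathbb D_\sigma(n,m)=\binom nm\sigma^m(1-\sigma)^{n-m},\qquad \mathbb D_\sigma f(n)=\sum_{m=0}^n f(m)\,\mathbb D_\sigma(n,m),\qquad n,m\in\mathbb Z_+ .$$ **Proposition 1.** Let $\sigma>0$. 1. For every bounded $f:\mathbb Z_+\to\mathbb R$ and every $x\ge0$, the expectations defining $\Lambda f(\sigma x)$ and $\Lambda\mathbb D_\sigma f(x)$ converge absolutely and $d_\sigma\Lambda f(x)=\Lambda\mathbb D_\sigma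 f(x)$. 2. ($\mathbb D$-self-similarity) For every $t>0$ one has $\mathbb Q^{(\beta)}_t\mathbb D_\sigma=\mathbb D_\sigma\mathbb Q^{(\beta)}_{\sigma t}$ wherever the left-hand side is defined. Precisely, let $f:\mathbb Z_+\to\mathbb R$ be bounded. Then $\mathbb Q^{(\beta)}_{\sigma t}f(n)$ converges absolutely for all $n$; and for every $n\in\mathbb Z_+$ for which the sum $\mathbb Q^{(\beta)}_t(\mathbb D_\sigma f)(n)=\sum_m\mathbb Q^{(\beta)}_t(n,m)\,\mathbb D_\sigma f(m)$ converges absolutely, $$\mathbb Q^{(\beta)}_t\mathbb D_\sigma f(n)=\mathbb D_\sigma\mathbb Q^{(\beta)}_{\sigma t}f(n).$$ This sum converges absolutely for all $n$ whenever $|f(m)|\le C\rho^m$ for all $m$, with some real $C$ and some $\rho\in[0,1]$ such that $(\sigma\rho+|1-\sigma|)\,t<1+t$ (with $0^0=1$); in particular for all bounded $f$ if $\sigma\le1$ or $2(\sigma-1)t<1$. -/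

import Mathlib

open MeasureTheory ProbabilityTheory
open scoped NNReal ENNReal

noncomputable section

namespace BirthDeath

/-- The linear birth-death generator
`G_β g(n) = (n + β) (g(n + 1) - g(n)) + n (g(n - 1) - g(n))` on functions on `ℤ₊`
(for `n = 0` the second term vanishes). -/
def generator (β : ℝ) (g : ℕ → ℝ) (n : ℕ) : ℝ :=
  (n + β) * (g (n + 1) - g n) + n * (g (n - 1) - g n)

/-- The infinite matrix of the generator, `G_β(n, m) = G_β[1_{m}](n)`. -/
def rate (β : ℝ) (n m : ℕ) : ℝ :=
  generator β (Pi.single m 1) n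

/-- For a continuous-time Markov chain on `ℤ₊` with matrix of jump rates `q` (jump from `n` to
`l ≠ n` at rate `q n l`, holding time at `n` exponential of parameter `- q n n`), the probability
`ℙ_n[X_t = m, exactly k jumps occur before time t]`, by conditioning on the first jump. -/
def jumpProb (q : ℕ → ℕ → ℝ) : ℕ → ℝ → ℕ → ℕ → ℝ≥0∞
  | 0, t, n, m => if n = m then ENNReal.ofReal (Real.exp (q n n * t)) else 0
  | k + 1, t, n, m =>
      ∫⁻ s in Set.Icc 0 t, ENNReal.ofReal (Real.exp (q n n * s)) *
        ∑' l, if l = n then 0 else ENNReal.ofReal (q n l) * jumpProb q k (t - s) l m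

/-- The (minimal) transition function `ℙ_n[X_t = m]` of the Markov chain with jump rates `q`. -/
def transProb (q : ℕ → ℕ → ℝ) (t : ℝ) (n m : ℕ) : ℝ≥0∞ :=
  ∑' k, jumpProb q k t n m

/-- The law at time `t` of the linear birth-death process with generator `G_β` started at `n`. -/
def law (β t : ℝ) (n : ℕ) : Measure ℕ :=
  Measure.sum fun m => transProb (rate β) t n m • Measure.dirac m

/-- The birth-death semigroup: `semigroup β t g n = 𝔼_n[g(X_t)]`. -/
def semigroup (β t : ℝ) (g : ℕ → ℝ) (n : ℕ) : ℝ :=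
  ∫ m, g m ∂(law β t n)

/-- The Poisson kernel `Λ g(x) = 𝔼[g(Pois(x))]`, `x ≥ 0`. -/
def poissonOp (g : ℕ → ℝ) (x : ℝ≥0) : ℝ :=
  ∫ n, g n ∂(poissonMeasure x)

/-- The dilation `d_σ f(x) = f(σ x)` on functions on `ℝ₊`. -/
def dilation (σ : ℝ≥0) (f : ℝ≥0 → ℝ) (x : ℝ≥0) : ℝ :=
  f (σ * x)

/-- The signed binomial kernel `D_σ(n, m) = C(n, m) σ^m (1 - σ)^(n - m)`, zero for `m > n`. -/
def binomialKernel (σ : ℝ) (n m : ℕ) : ℝ :=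
  (n.choose m : ℝ) * σ ^ m * (1 - σ) ^ (n - m)

/-- `D_σ f(n) = ∑_{m = 0}^n f(m) D_σ(n, m)`. -/
def binomialOp (σ : ℝ) (f : ℕ → ℝ) (n : ℕ) : ℝ :=
  ∑ m ∈ Finset.range (n + 1), f m * binomialKernel σ n m

end BirthDeath

end

namespace BirthDeath

open Set

/-! The Poisson identity is a Cauchy product: the exponential generating series of `binomialOp σ f`
is that of `f` at `σ x` times `exp (x (1 - σ))` (`dilation_poissonOp`).

For the semigroup, the functions `z ^ ·` decide everything. The binomial operator sends `z ^ ·` to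
`(1 - σ + σ z) ^ ·`, and the law at time `t` has the explicit generating function `pgf`
(`tsum_transProb`), obtained as the minimal solution of the backward equation, with equality on `[0,
1]` because the process does not explode. The identity for `z ^ ·` is then algebra
(`sum_binomialKernel_mul_pgf`).

Passing to bounded `f` is the difficulty: for `σ > 1` the double sum over `m` and `k` need not
converge absolutely, even if the sum over `m` of `binomialOp σ f m` does. So a factor `r ^ m` is
inserted. For small `r` Fubini applies, and uniqueness of generating functions gives the closed form
`thinnedPairing`. That form is analytic near every `r` in `[0, 1]`, while the left side is a power
series in `r` with absolutely summable coefficients. The identity theorem carries the equality to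
`(0, 1)` and continuity to `r = 1` (`semigroup_binomialOp`). -/

/-! ### First-jump recursion and the backward equation. -/

theorem rate_self (β : ℝ) (n : ℕ) : rate β n n = -(2 * n + β) := by
  rcases n with _ | n
  · simp [rate, generator]
  · simp [rate, generator]; ring

/-- One step of the first-jump recursion of the birth-death process. -/
noncomputable def firstJump (β : ℝ) (h : ℕ → ℝ → ℝ≥0∞) (n : ℕ) (t : ℝ) : ℝ≥0∞ :=
  ∫⁻ s in Icc 0 t, ENNReal.ofReal (Real.exp (-(2 * n + β) * s)) *
    (ENNReal.ofReal (n + β) * h (n + 1) (t - s) + ENNReal.ofReal n * h (n - 1) (t - s))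

/-- Only nearest-neighbour jumps have positive rate. At `n = 0` the truncated `n - 1` is harmless,
since its coefficient vanishes. -/
theorem tsum_rate_mul {β : ℝ} (n : ℕ) (h : ℕ → ℝ≥0∞) :
    (∑' l, if l = n then 0 else ENNReal.ofReal (rate β n l) * h l) =
      ENNReal.ofReal (n + β) * h (n + 1) + ENNReal.ofReal n * h (n - 1) := by
  rcases n with _ | n
  · rw [tsum_eq_single 1]
    · simp [rate, generator]
    · intro l hl
      by_cases h0 : l = 0
      · simp [h0]
      · simp [rate, generator, h0, Ne.symm hl, Ne.symm h0]
  · rw [tsum_eq_sum (s := {n + 2, n})]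
    · rw [Finset.sum_pair (by omega)]
      have h2 : n + 1 + 1 ≠ n := by omega
      simp [rate, generator, h2]
    · intro l hl
      simp only [Finset.mem_insert, Finset.mem_singleton, not_or] at hl
      by_cases h0 : l = n + 1
      · simp [h0]
      · have h1 : n ≠ l := Ne.symm hl.2
        have h2 : n + 1 + 1 ≠ l := Ne.symm hl.1
        simp [rate, generator, h0, h1, h2, Ne.symm h0]

theorem jumpProb_succ (β : ℝ) (k : ℕ) (t : ℝ) (n m : ℕ) :
    jumpProb (rate β) (k + 1) t n m =
      firstJump β (fun l t => jumpProb (rate β) k t l m) n t := by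
  simp only [jumpProb, firstJump, rate_self, tsum_rate_mul]

theorem firstJump_mono {β : ℝ} {h h' : ℕ → ℝ → ℝ≥0∞} {t : ℝ}
    (hh : ∀ n, ∀ s ∈ Icc 0 t, h n s ≤ h' n s) (n : ℕ) :
    firstJump β h n t ≤ firstJump β h' n t := by
  refine setLIntegral_mono' measurableSet_Icc fun s hs => ?_
  have : t - s ∈ Icc 0 t := ⟨by linarith [hs.2], by linarith [hs.1]⟩
  gcongr <;> exact hh _ _ this

theorem measurable_firstJump {β : ℝ} {h : ℕ → ℝ → ℝ≥0∞} (hh : ∀ n, Measurable (h n)) (n : ℕ) :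
    Measurable (firstJump β h n) := by
  have h1 := hh (n + 1)
  have h2 := hh (n - 1)
  -- The domain of integration moves with `t`, so the integrand is made jointly measurable on the
  -- triangle `0 ≤ s ≤ t`.
  have hF : Measurable fun p : ℝ × ℝ => {p : ℝ × ℝ | 0 ≤ p.2 ∧ p.2 ≤ p.1}.indicator
      (fun p => ENNReal.ofReal (Real.exp (-(2 * n + β) * p.2)) *
        (ENNReal.ofReal (n + β) * h (n + 1) (p.1 - p.2) +
          ENNReal.ofReal n * h (n - 1) (p.1 - p.2))) p := by
    refine Measurable.indicator (by fun_prop) ?_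
    exact (measurableSet_le measurable_const measurable_snd).inter
      (measurableSet_le measurable_snd measurable_fst)
  convert hF.lintegral_prod_right' (ν := volume) using 2 with t
  rw [firstJump, ← lintegral_indicator measurableSet_Icc]
  rfl

theorem firstJump_add {β : ℝ} {h h' : ℕ → ℝ → ℝ≥0∞} (hh : ∀ n, Measurable (h n)) (n : ℕ) (t : ℝ) :
    firstJump β (fun l s => h l s + h' l s) n t = firstJump β h n t + firstJump β h' n t := by
  have h1 := hh (n + 1)
  have h2 := hh (n - 1)
  rw [firstJump, firstJump, firstJump, ← lintegral_add_left (by fun_prop)]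
  congr 1 with s
  ring

theorem firstJump_tsum {β : ℝ} {h : ℕ → ℕ → ℝ → ℝ≥0∞} (hh : ∀ m n, Measurable (h m n))
    (n : ℕ) (t : ℝ) :
    firstJump β (fun l s => ∑' m, h m l s) n t = ∑' m, firstJump β (h m) n t := by
  simp only [firstJump]
  rw [← lintegral_tsum]
  · congr 1 with s
    rw [← ENNReal.tsum_mul_left, ← ENNReal.tsum_mul_left, ← ENNReal.tsum_add,
      ← ENNReal.tsum_mul_left]
  · intro m
    have h1 := hh m (n + 1)
    have h2 := hh m (n - 1)
    fun_prop

theorem firstJump_mul_const {β : ℝ} {h : ℕ → ℝ → ℝ≥0∞} (hh : ∀ n, Measurable (h n)) (c : ℝ≥0∞)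
    (n : ℕ) (t : ℝ) :
    firstJump β (fun l s => h l s * c) n t = firstJump β h n t * c := by
  have h1 := hh (n + 1)
  have h2 := hh (n - 1)
  rw [firstJump, firstJump, ← lintegral_mul_const _ (by fun_prop)]
  congr 1 with s
  ring

theorem measurable_jumpProb (β : ℝ) (m k n : ℕ) :
    Measurable fun t => jumpProb (rate β) k t n m := by
  induction k generalizing n with
  | zero =>
    simp only [jumpProb]
    split_ifs <;> fun_prop
  | succ k ih =>
    simp only [jumpProb_succ]
    exact measurable_firstJump ih n

/-- Variation of constants for the backward equation with constant source `c`. -/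
theorem firstJump_ofReal {β : ℝ} (hβ : 0 ≤ β) {g : ℕ → ℝ → ℝ} {c t : ℝ} (hc : 0 ≤ c) (ht : 0 ≤ t)
    {n : ℕ} (hg : ∀ l, ∀ s ∈ Icc 0 t, 0 ≤ g l s) (hcont : ∀ l, ContinuousOn (g l) (Icc 0 t))
    (hder : ∀ s ∈ Icc 0 t, HasDerivAt (g n)
      ((n + β) * g (n + 1) s + n * g (n - 1) s - (2 * n + β) * g n s + c) s) :
    ENNReal.ofReal (Real.exp (-(2 * n + β) * t) * g n 0) +
      (∫⁻ s in Icc 0 t, ENNReal.ofReal (Real.exp (-(2 * n + β) * s)) *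
        (ENNReal.ofReal (n + β) * ENNReal.ofReal (g (n + 1) (t - s)) +
          ENNReal.ofReal n * ENNReal.ofReal (g (n - 1) (t - s)) + ENNReal.ofReal c)) =
      ENNReal.ofReal (g n t) := by
  have hmaps : MapsTo (fun s => t - s) (Icc 0 t) (Icc 0 t) :=
    fun s hs => ⟨by linarith [hs.2], by linarith [hs.1]⟩
  have hcont' : ∀ l, ContinuousOn (fun s => g l (t - s)) (Icc 0 t) := fun l =>
    (hcont l).comp (by fun_prop) hmaps
  set F : ℝ → ℝ := fun s => Real.exp (-(2 * n + β) * s) *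
    ((n + β) * g (n + 1) (t - s) + n * g (n - 1) (t - s) + c) with hF
  have hFc : ContinuousOn F (Icc 0 t) := by
    have h1 := hcont' (n + 1)
    have h2 := hcont' (n - 1)
    fun_prop
  have hFnn : ∀ s ∈ Icc 0 t, 0 ≤ F s := fun s hs => by
    have h1 := hg (n + 1) _ (hmaps hs)
    have h2 := hg (n - 1) _ (hmaps hs)
    simp only at h1 h2
    positivity
  have e1 : (∫⁻ s in Icc 0 t, ENNReal.ofReal (Real.exp (-(2 * n + β) * s)) *
      (ENNReal.ofReal (n + β) * ENNReal.ofReal (g (n + 1) (t - s)) +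
        ENNReal.ofReal n * ENNReal.ofReal (g (n - 1) (t - s)) + ENNReal.ofReal c)) =
      ∫⁻ s in Icc 0 t, ENNReal.ofReal (F s) := by
    refine setLIntegral_congr_fun measurableSet_Icc fun s hs => ?_
    have h1 : 0 ≤ g (n + 1) (t - s) := hg (n + 1) _ (hmaps hs)
    have h2 : 0 ≤ g (n - 1) (t - s) := hg (n - 1) _ (hmaps hs)
    simp only [hF]
    rw [ENNReal.ofReal_mul (by positivity),
      ENNReal.ofReal_add (p := _ + _) (by positivity) hc,
      ENNReal.ofReal_add (p := _ * _) (by positivity) (by positivity),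
      ENNReal.ofReal_mul (p := _ + _) (by positivity), ENNReal.ofReal_mul (by positivity)]
  have e2 : ∫ s in Icc 0 t, F s = g n t - Real.exp (-(2 * n + β) * t) * g n 0 := by
    rw [integral_Icc_eq_integral_Ioc, ← intervalIntegral.integral_of_le ht,
      intervalIntegral.integral_eq_sub_of_hasDerivAt
        (f := fun s => -(Real.exp (-(2 * n + β) * s) * g n (t - s)))]
    · simp; ring
    · intro s hs
      rw [uIcc_of_le ht] at hs
      have h1 : HasDerivAt (fun s => Real.exp (-(2 * n + β) * s))
          (Real.exp (-(2 * n + β) * s) * (-(2 * n + β) * 1)) s :=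
        ((hasDerivAt_id s).const_mul _).exp
      have h2 := HasDerivAt.comp s (hder _ (hmaps hs)) ((hasDerivAt_id s).const_sub t)
      refine (h1.mul h2).neg.congr_deriv ?_
      simp [hF]; ring
    · rw [intervalIntegrable_iff_integrableOn_Icc_of_le ht]
      exact hFc.integrableOn_Icc
  have e3 : 0 ≤ ∫ s in Icc 0 t, F s := setIntegral_nonneg measurableSet_Icc hFnn
  have h0 := hg n 0 ⟨le_rfl, ht⟩
  rw [e1, ← ofReal_integral_eq_lintegral_ofReal hFc.integrableOn_Icc
    ((ae_restrict_iff' measurableSet_Icc).2 (.of_forall hFnn)),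
    ← ENNReal.ofReal_add (by positivity) e3, e2]
  congr 1
  ring

/-! ### Non-explosion. -/

/-- `ℙ_n[at least k jumps before time t]`. -/
noncomputable def jumpTail (β : ℝ) : ℕ → ℕ → ℝ → ℝ≥0∞
  | 0 => fun _ _ => 1
  | k + 1 => firstJump β (jumpTail β k)

theorem measurable_jumpTail (β : ℝ) (k n : ℕ) : Measurable (jumpTail β k n) := by
  induction k generalizing n with
  | zero => exact measurable_const
  | succ k ih => exact measurable_firstJump ih n

/-- The expected number of jumps is finite. -/
theorem sum_jumpTail_le {β : ℝ} (hβ : 0 ≤ β) (K n : ℕ) {t : ℝ} (ht : 0 ≤ t) :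
    ∑ k ∈ Finset.range K, jumpTail β (k + 1) n t ≤
      ENNReal.ofReal (2 * n * t + β * t ^ 2 + β * t) := by
  induction K generalizing n t with
  | zero => simp
  | succ K ih =>
    have key : ∑ k ∈ Finset.range (K + 1), jumpTail β (k + 1) n t =
        firstJump β (fun l s => 1 + ∑ k ∈ Finset.range K, jumpTail β (k + 1) l s) n t := by
      clear ih
      induction K with
      | zero => simp [jumpTail]
      | succ K ih =>
        rw [Finset.sum_range_succ, ih]
        simp only [Finset.sum_range_succ _ K, ← add_assoc]
        rw [firstJump_add (h := fun l s => 1 + ∑ k ∈ Finset.range K, jumpTail β (k + 1) l s)]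
        · rfl
        · intro l
          exact measurable_const.add
            (Finset.measurable_fun_sum _ fun k _ => measurable_jumpTail β (k + 1) l)
    rw [key]
    -- The bound is the exact mean number of jumps: the mean position is `n + β s`, and the total
    -- jump rate `2 X + β` is integrated over `[0, t]`. The source `c` is the total rate at `n`.
    have h0 := firstJump_ofReal hβ (g := fun n t => 2 * n * t + β * t ^ 2 + β * t)
      (c := 2 * n + β) (by positivity) ht (n := n)
      (fun l s hs => by have := hs.1; positivity) (fun l => by fun_prop)
      (fun s hs => by
        refine ((((hasDerivAt_id s).const_mul (2 * (n : ℝ))).add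
          (((hasDerivAt_id s).pow 2).const_mul β)).add
          ((hasDerivAt_id s).const_mul β)).congr_deriv ?_
        rcases n with _ | n
        · simp; ring
        · simp; ring)
    refine (firstJump_mono (h' := fun l s =>
      1 + ENNReal.ofReal (2 * l * s + β * s ^ 2 + β * s)) (fun l s hs => ?_) n).trans ?_
    · gcongr
      exact ih l hs.1
    · rw [← h0]
      refine le_add_left (le_of_eq ?_)
      rw [firstJump]
      congr 1 with s
      have : ENNReal.ofReal (2 * n + β) = ENNReal.ofReal (n + β) + ENNReal.ofReal n := by
        rw [← ENNReal.ofReal_add (by positivity) (by positivity)]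
        congr 1
        ring
      rw [this]
      ring

/-- The tails sum to the mean number of jumps, which is finite. -/
theorem tendsto_jumpTail {β : ℝ} (hβ : 0 ≤ β) (n : ℕ) {t : ℝ} (ht : 0 ≤ t) :
    Filter.Tendsto (fun k => jumpTail β k n t) Filter.atTop (nhds 0) := by
  rw [← Filter.tendsto_add_atTop_iff_nat 1]
  refine ENNReal.tendsto_atTop_zero_of_tsum_ne_top (ne_top_of_le_ne_top
    (ENNReal.ofReal_ne_top (r := 2 * n * t + β * t ^ 2 + β * t)) ?_)
  rw [ENNReal.tsum_eq_iSup_nat]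
  exact iSup_le fun K => sum_jumpTail_le hβ K n ht

/-! ### The generating function of the transition probabilities. -/

/-- Generating function of the position restricted to `k` jumps. -/
noncomputable def jumpGen (β : ℝ) (y : ℝ≥0∞) (k n : ℕ) (t : ℝ) : ℝ≥0∞ :=
  ∑' m, jumpProb (rate β) k t n m * y ^ m

theorem jumpGen_zero (β : ℝ) (y : ℝ≥0∞) (n : ℕ) (t : ℝ) :
    jumpGen β y 0 n t = ENNReal.ofReal (Real.exp (-(2 * n + β) * t)) * y ^ n := by
  rw [jumpGen, tsum_eq_single n]
  · simp [jumpProb, rate_self]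
  · intro m hm
    simp [jumpProb, Ne.symm hm]

theorem jumpGen_succ (β : ℝ) (y : ℝ≥0∞) (k n : ℕ) (t : ℝ) :
    jumpGen β y (k + 1) n t = firstJump β (jumpGen β y k) n t := by
  have : jumpGen β y k = fun l s => ∑' m, jumpProb (rate β) k s l m * y ^ m := rfl
  rw [this, firstJump_tsum (h := fun m l s => jumpProb (rate β) k s l m * y ^ m)
    (fun m l => (measurable_jumpProb β m k l).mul_const _), jumpGen]
  congr 1 with m
  rw [jumpProb_succ, firstJump_mul_const fun l => measurable_jumpProb β m k l]

theorem measurable_jumpGen (β : ℝ) (y : ℝ≥0∞) (k n : ℕ) : Measurable (jumpGen β y k n) :=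
  Measurable.tsum fun m => (measurable_jumpProb β m k n).mul_const _

/-- The partial sums are the Picard iterates, started at `0`, of the backward integral equation. -/
theorem sum_jumpGen_succ (β : ℝ) (y : ℝ≥0∞) (K n : ℕ) (t : ℝ) :
    ∑ k ∈ Finset.range (K + 1), jumpGen β y k n t =
      ENNReal.ofReal (Real.exp (-(2 * n + β) * t)) * y ^ n +
        firstJump β (fun l s => ∑ k ∈ Finset.range K, jumpGen β y k l s) n t := by
  induction K with
  | zero => simp [jumpGen_zero, firstJump]
  | succ K ih =>
    rw [Finset.sum_range_succ, ih, jumpGen_succ]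
    simp only [Finset.sum_range_succ _ K]
    rw [firstJump_add (h := fun l s => ∑ k ∈ Finset.range K, jumpGen β y k l s), add_assoc]
    exact fun l => Finset.measurable_fun_sum _ fun k _ => measurable_jumpGen β y k l

theorem tsum_transProb_mul_pow_eq (β : ℝ) (y : ℝ≥0∞) (n : ℕ) (t : ℝ) :
    ∑' m, transProb (rate β) t n m * y ^ m = ∑' k, jumpGen β y k n t := by
  simp only [transProb, jumpGen, ← ENNReal.tsum_mul_right]
  exact ENNReal.tsum_comm

/-- The probability generating function of the birth-death process with immigration. -/
noncomputable def pgf (β y : ℝ) (n : ℕ) (t : ℝ) : ℝ :=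
  (1 + t * (1 - y)) ^ (-β) * (1 - (1 - y) / (1 + t * (1 - y))) ^ n

theorem pgf_base_pos {y s t : ℝ} (hyt : (y - 1) * t < 1) (hs : s ∈ Icc 0 t) :
    0 < 1 + s * (1 - y) := by
  rcases le_total y 1 with h | h
  · have := mul_nonneg hs.1 (sub_nonneg.2 h)
    linarith
  · nlinarith [hs.1, hs.2]

theorem pgf_ratio_nonneg {y s : ℝ} (hy : 0 ≤ y) (hs : 0 ≤ s) (h : 0 < 1 + s * (1 - y)) :
    0 ≤ 1 - (1 - y) / (1 + s * (1 - y)) := by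
  rw [sub_nonneg, div_le_one h]
  rcases le_total y 1 with h' | h'
  · nlinarith
  · linarith

theorem pgf_nonneg {β y t : ℝ} (hy : 0 ≤ y) (hyt : (y - 1) * t < 1) (n : ℕ) {s : ℝ}
    (hs : s ∈ Icc 0 t) : 0 ≤ pgf β y n s := by
  have h := pgf_base_pos hyt hs
  exact mul_nonneg (Real.rpow_nonneg h.le _) (pow_nonneg (pgf_ratio_nonneg hy hs.1 h) _)

theorem hasDerivAt_pgf {β y s : ℝ} (h : 0 < 1 + s * (1 - y)) (n : ℕ) :
    HasDerivAt (pgf β y n) ((n + β) * pgf β y (n + 1) s + n * pgf β y (n - 1) s -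
      (2 * n + β) * pgf β y n s) s := by
  have h1 : HasDerivAt (fun s => 1 + s * (1 - y)) (1 * (1 - y)) s :=
    ((hasDerivAt_id s).mul_const (1 - y)).const_add 1
  have h2 := h1.rpow_const (p := -β) (Or.inl h.ne')
  have h3 := (((hasDerivAt_const s (1 - y)).div h1 h.ne').const_sub 1).pow n
  refine (h2.mul h3).congr_deriv ?_
  have e : (1 + s * (1 - y)) ^ (-β - 1) = (1 + s * (1 - y)) ^ (-β) / (1 + s * (1 - y)) := by
    rw [Real.rpow_sub h, Real.rpow_one]
  simp only [pgf, Pi.pow_apply, Pi.div_apply, e]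
  set b := 1 + s * (1 - y) with hb
  set w := 1 - y
  -- The case `n = 0` is separate because `n - 1` truncates.
  rcases n with _ | n
  · have hb0 := h.ne'
    field_simp
    simp
    field_simp
    rw [hb]
    ring
  · simp only [Nat.add_sub_cancel, pow_succ]
    set P := (1 - w / b) ^ n
    push_cast
    field_simp
    ring

theorem ofReal_pgf_eq {β y t : ℝ} (hβ : 0 ≤ β) (hy : 0 ≤ y) (hyt : (y - 1) * t < 1) (n : ℕ) {s : ℝ}
    (hs : s ∈ Icc 0 t) :
    ENNReal.ofReal (pgf β y n s) = ENNReal.ofReal (Real.exp (-(2 * n + β) * s)) *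
      ENNReal.ofReal y ^ n + firstJump β (fun l s => ENNReal.ofReal (pgf β y l s)) n s := by
  have hsub : Icc 0 s ⊆ Icc 0 t := Icc_subset_Icc_right hs.2
  have h0 := firstJump_ofReal hβ (g := pgf β y) (c := 0) le_rfl hs.1 (n := n)
    (fun l r hr => pgf_nonneg hy hyt l (hsub hr))
    (fun l r hr => (hasDerivAt_pgf (pgf_base_pos hyt (hsub hr)) l).continuousAt.continuousWithinAt)
    (fun r hr => by simpa using hasDerivAt_pgf (pgf_base_pos hyt (hsub hr)) n)
  simp only [ENNReal.ofReal_zero, add_zero] at h0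
  have hz : pgf β y n 0 = y ^ n := by simp [pgf]
  rw [← h0, hz, ENNReal.ofReal_mul (by positivity), ENNReal.ofReal_pow hy]
  rfl

/-- Minimality: a nonnegative solution dominates all Picard iterates. This also works for `y > 1`,
up to the pole at `(y - 1) t = 1`. -/
theorem tsum_transProb_le {β y t : ℝ} (hβ : 0 ≤ β) (hy : 0 ≤ y) (hyt : (y - 1) * t < 1)
    (ht : 0 ≤ t) (n : ℕ) :
    ∑' m, transProb (rate β) t n m * ENNReal.ofReal y ^ m ≤ ENNReal.ofReal (pgf β y n t) := by
  have key : ∀ K n, ∀ s ∈ Icc 0 t, ∑ k ∈ Finset.range K, jumpGen β (ENNReal.ofReal y) k n s ≤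
      ENNReal.ofReal (pgf β y n s) := by
    intro K
    induction K with
    | zero => simp
    | succ K ih =>
      intro n s hs
      rw [sum_jumpGen_succ, ofReal_pgf_eq hβ hy hyt n hs]
      gcongr
      exact firstJump_mono (fun l r hr => ih l r ⟨hr.1, hr.2.trans hs.2⟩) n
  rw [tsum_transProb_mul_pow_eq, ENNReal.tsum_eq_iSup_nat]
  exact iSup_le fun K => key K n t ⟨ht, le_rfl⟩

/-- For `y ≤ 1` the solution is at most `1`, so by induction its gap to the `K`-th iterate is at
most the probability of `K` jumps, which tends to `0`. -/
theorem tsum_transProb {β y t : ℝ} (hβ : 0 ≤ β) (hy : 0 ≤ y) (hy1 : y ≤ 1)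
    (ht : 0 ≤ t) (n : ℕ) :
    ∑' m, transProb (rate β) t n m * ENNReal.ofReal y ^ m = ENNReal.ofReal (pgf β y n t) := by
  have hyt : (y - 1) * t < 1 := by nlinarith
  refine le_antisymm (tsum_transProb_le hβ hy hyt ht n) ?_
  have key : ∀ K n, ∀ s ∈ Icc 0 t, ENNReal.ofReal (pgf β y n s) ≤
      ∑ k ∈ Finset.range K, jumpGen β (ENNReal.ofReal y) k n s + jumpTail β K n s := by
    intro K
    induction K with
    | zero =>
      intro n s hs
      have h := pgf_base_pos hyt hs
      have h1 : 1 ≤ 1 + s * (1 - y) := by nlinarith [hs.1]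
      simp only [Finset.range_zero, Finset.sum_empty, zero_add, jumpTail, ENNReal.ofReal_le_one]
      refine mul_le_one₀ (Real.rpow_le_one_of_one_le_of_nonpos h1 (by linarith))
        (pow_nonneg (pgf_ratio_nonneg hy hs.1 h) _) (pow_le_one₀ (pgf_ratio_nonneg hy hs.1 h) ?_)
      have : 0 ≤ (1 - y) / (1 + s * (1 - y)) := div_nonneg (by linarith) h.le
      linarith
    | succ K ih =>
      intro n s hs
      rw [sum_jumpGen_succ, ofReal_pgf_eq hβ hy hyt n hs, add_assoc]
      gcongr
      rw [jumpTail, ← firstJump_add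
        (h := fun l s => ∑ k ∈ Finset.range K, jumpGen β (ENNReal.ofReal y) k l s)]
      · exact firstJump_mono (fun l r hr => ih l r ⟨hr.1, hr.2.trans hs.2⟩) n
      · exact fun l => Finset.measurable_fun_sum _ fun k _ => measurable_jumpGen β _ k l
  rw [tsum_transProb_mul_pow_eq]
  refine ge_of_tendsto' (x := Filter.atTop)
    (f := fun K => ∑ k ∈ Finset.range K, jumpGen β (ENNReal.ofReal y) k n t + jumpTail β K n t)
    ?_ fun K => key K n t ⟨ht, le_rfl⟩
  simpa using ENNReal.summable.hasSum.tendsto_sum_nat.add (tendsto_jumpTail hβ n ht)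

theorem tsum_transProb_eq_one {β t : ℝ} (hβ : 0 ≤ β) (ht : 0 ≤ t) (n : ℕ) :
    ∑' m, transProb (rate β) t n m = 1 := by
  simpa [pgf] using tsum_transProb hβ zero_le_one le_rfl ht n

theorem transProb_ne_top {β t : ℝ} (hβ : 0 ≤ β) (ht : 0 ≤ t) (n m : ℕ) :
    transProb (rate β) t n m ≠ ∞ :=
  ne_top_of_le_ne_top (by rw [tsum_transProb_eq_one hβ ht n]; exact ENNReal.one_ne_top)
    (ENNReal.le_tsum m)

/-! ### Integrability under the law and bounds on the signed binomial kernel. -/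

theorem integrable_law_iff {β t : ℝ} (hβ : 0 ≤ β) (ht : 0 ≤ t) (n : ℕ) (f : ℕ → ℝ) :
    Integrable f (law β t n) ↔
      Summable fun m => (transProb (rate β) t n m).toReal * |f m| :=
  integrable_sum_dirac_iff (transProb_ne_top hβ ht n)

theorem semigroup_eq_tsum {β t : ℝ} (hβ : 0 ≤ β) (ht : 0 ≤ t) (f : ℕ → ℝ) (n : ℕ) :
    semigroup β t f n = ∑' m, (transProb (rate β) t n m).toReal * f m :=
  integral_sum_dirac (transProb_ne_top hβ ht n)

theorem summable_transProb_mul_pow {β y t : ℝ} (hβ : 0 ≤ β) (hy : 0 ≤ y) (hyt : (y - 1) * t < 1)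
    (ht : 0 ≤ t) (n : ℕ) : Summable fun m => (transProb (rate β) t n m).toReal * y ^ m := by
  convert ENNReal.summable_toReal
    (ne_top_of_le_ne_top ENNReal.ofReal_ne_top (tsum_transProb_le hβ hy hyt ht n)) using 2
  simp [ENNReal.toReal_ofReal hy]

theorem hasSum_transProb_mul_pow {β y t : ℝ} (hβ : 0 ≤ β) (hy : 0 ≤ y) (hy1 : y ≤ 1)
    (ht : 0 ≤ t) (n : ℕ) :
    HasSum (fun m => (transProb (rate β) t n m).toReal * y ^ m) (pgf β y n t) := by
  have hyt : (y - 1) * t < 1 := by nlinarith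
  rw [(summable_transProb_mul_pow hβ hy hyt ht n).hasSum_iff,
    ← ENNReal.toReal_ofReal (pgf_nonneg (β := β) hy hyt n ⟨ht, le_rfl⟩),
    ← tsum_transProb hβ hy hy1 ht n, ENNReal.tsum_toReal_eq]
  · simp [ENNReal.toReal_ofReal hy]
  · exact fun m => ENNReal.mul_ne_top (transProb_ne_top hβ ht n m)
      (ENNReal.pow_ne_top ENNReal.ofReal_ne_top)

theorem summable_transProb {β t : ℝ} (hβ : 0 ≤ β) (ht : 0 ≤ t) (n : ℕ) :
    Summable fun m => (transProb (rate β) t n m).toReal := by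
  simpa using (hasSum_transProb_mul_pow hβ zero_le_one le_rfl ht n).summable

theorem summable_transProb_mul_of_bounded {β t : ℝ} (hβ : 0 ≤ β) (ht : 0 ≤ t) (n : ℕ) {f : ℕ → ℝ}
    {C : ℝ} (hf : ∀ m, |f m| ≤ C) :
    Summable fun m => (transProb (rate β) t n m).toReal * |f m| :=
  ((summable_transProb hβ ht n).mul_right C).of_nonneg_of_le (fun m => by positivity)
    fun m => by gcongr; exact hf m

theorem abs_binomialKernel {σ : ℝ} (hσ : 0 ≤ σ) (n m : ℕ) :
    |binomialKernel σ n m| = n.choose m * σ ^ m * |1 - σ| ^ (n - m) := by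
  simp [binomialKernel, abs_mul, abs_pow, abs_of_nonneg hσ]

theorem sum_abs_binomialKernel_mul_pow {σ : ℝ} (hσ : 0 ≤ σ) (ρ : ℝ) (n : ℕ) :
    ∑ m ∈ Finset.range (n + 1), |binomialKernel σ n m| * ρ ^ m = (σ * ρ + |1 - σ|) ^ n := by
  rw [add_pow]
  refine Finset.sum_congr rfl fun m _ => ?_
  rw [abs_binomialKernel hσ, mul_pow]
  ring

theorem sum_binomialKernel_mul_pow (σ z : ℝ) (n : ℕ) :
    ∑ m ∈ Finset.range (n + 1), binomialKernel σ n m * z ^ m = (1 - σ + σ * z) ^ n := by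
  rw [add_comm (1 - σ), add_pow]
  refine Finset.sum_congr rfl fun m _ => ?_
  rw [binomialKernel, mul_pow]
  ring

theorem abs_binomialOp_le {σ : ℝ} (hσ : 0 ≤ σ) {f : ℕ → ℝ} {C ρ : ℝ}
    (hf : ∀ n, |f n| ≤ C * ρ ^ n) (n : ℕ) :
    |binomialOp σ f n| ≤ C * (σ * ρ + |1 - σ|) ^ n := by
  rw [← sum_abs_binomialKernel_mul_pow hσ, Finset.mul_sum]
  refine (Finset.abs_sum_le_sum_abs _ _).trans (Finset.sum_le_sum fun m _ => ?_)
  rw [abs_mul]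
  calc |f m| * |binomialKernel σ n m| ≤ C * ρ ^ m * |binomialKernel σ n m| := by
        gcongr; exact hf m
    _ = _ := by ring

/-- `binomialOp σ f` grows at most like `y ^ n` with `y = σ ρ + |1 - σ|`; the hypothesis says
exactly that `y` lies before the pole, `(y - 1) t < 1`. -/
theorem integrable_binomialOp_law {β t σ : ℝ} (hβ : 0 ≤ β) (ht : 0 ≤ t) (hσ : 0 ≤ σ)
    {f : ℕ → ℝ} {C ρ : ℝ} (hρ : 0 ≤ ρ) (hf : ∀ n, |f n| ≤ C * ρ ^ n)
    (h : (σ * ρ + |1 - σ|) * t < 1 + t) (n : ℕ) :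
    Integrable (binomialOp σ f) (law β t n) := by
  rw [integrable_law_iff hβ ht]
  refine ((summable_transProb_mul_pow (y := σ * ρ + |1 - σ|) hβ (by positivity) (by linarith)
    ht n).mul_left C).of_nonneg_of_le (fun m => by positivity) fun m => ?_
  calc _ ≤ (transProb (rate β) t n m).toReal * (C * (σ * ρ + |1 - σ|) ^ m) := by
        gcongr; exact abs_binomialOp_le hσ hf m
    _ = _ := by ring

/-! ### The Poisson intertwining. -/

theorem integrable_poissonMeasure_of_bounded {f : ℕ → ℝ} {C : ℝ} (hf : ∀ n, |f n| ≤ C) (x : ℝ≥0) :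
    Integrable f (poissonMeasure x) :=
  Integrable.of_bound (measurable_of_countable f).aestronglyMeasurable C (.of_forall hf)

open Nat in
theorem integrable_binomialOp_poissonMeasure {σ : ℝ} (hσ : 0 ≤ σ) {f : ℕ → ℝ} {C : ℝ}
    (hf : ∀ n, |f n| ≤ C) (x : ℝ≥0) : Integrable (binomialOp σ f) (poissonMeasure x) := by
  rw [integrable_poissonMeasure_iff]
  have h : Summable fun n => Real.exp (-x) * C * ((x * (σ + |1 - σ|)) ^ n / n !) :=
    (Real.summable_pow_div_factorial _).mul_left _
  refine h.of_nonneg_of_le (fun n => by positivity) fun n => ?_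
  have := abs_binomialOp_le hσ (C := C) (ρ := 1) (by simpa using hf) n
  rw [Real.norm_eq_abs]
  calc _ ≤ Real.exp (-x) * x ^ n / n ! * (C * (σ * 1 + |1 - σ|) ^ n) := by gcongr
    _ = _ := by rw [mul_pow, mul_one]; ring

open Nat in
theorem dilation_poissonOp (σ : ℝ≥0) {f : ℕ → ℝ} {C : ℝ} (hf : ∀ n, |f n| ≤ C) (x : ℝ≥0) :
    dilation σ (poissonOp f) x = poissonOp (binomialOp σ f) x := by
  have hu : Summable fun k => ‖((σ * x : ℝ) ^ k / k !) * f k‖ := by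
    refine ((Real.summable_pow_div_factorial (σ * x : ℝ)).mul_right C).of_nonneg_of_le
      (fun n => by positivity) fun n => ?_
    rw [norm_mul, Real.norm_of_nonneg (by positivity)]
    gcongr
    exact hf n
  have hv : Summable fun i => ‖(x * (1 - σ) : ℝ) ^ i / (i !)‖ :=
    (Real.summable_pow_div_factorial _).norm
  have hprod := tsum_mul_tsum_eq_tsum_sum_range_of_summable_norm hu hv
  have hexp : ∑' i, (x * (1 - σ) : ℝ) ^ i / (i !) = Real.exp (x * (1 - σ)) := by
    rw [Real.exp_eq_exp_ℝ, NormedSpace.exp_eq_tsum_div]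
  rw [dilation, poissonOp, poissonOp, integral_poissonMeasure, integral_poissonMeasure]
  have e1 : ∀ n, (Real.exp (-x) * x ^ n / n ! : ℝ) • binomialOp σ f n = Real.exp (-x) *
      ∑ k ∈ Finset.range (n + 1), ((σ * x : ℝ) ^ k / k ! * f k) *
        ((x * (1 - σ) : ℝ) ^ (n - k) / (n - k)!) := by
    intro n
    rw [binomialOp, smul_eq_mul, Finset.mul_sum, Finset.mul_sum]
    refine Finset.sum_congr rfl fun k hk => ?_
    have hkn : k ≤ n := Nat.lt_succ_iff.1 (Finset.mem_range.1 hk)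
    rw [binomialKernel, Nat.cast_choose ℝ hkn]
    have h1 : (x : ℝ) ^ n = x ^ k * x ^ (n - k) := by rw [← pow_add, Nat.add_sub_cancel' hkn]
    rw [h1, mul_pow, mul_pow]
    have := n.factorial_ne_zero
    field_simp
  simp_rw [e1]
  rw [tsum_mul_left, ← hprod, hexp, mul_left_comm, ← Real.exp_add, ← tsum_mul_right]
  refine tsum_congr fun k => ?_
  rw [smul_eq_mul, show -(x : ℝ) + x * (1 - σ) = -(σ * x) by ring]
  push_cast
  ring

/-! ### Power series on the unit disc and uniqueness of coefficients. -/

theorem hasFPowerSeriesOnBall_tsum {q : ℕ → ℝ}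
    (hq : ∀ r : ℝ≥0, r < 1 → Summable fun k => |q k| * (r : ℝ) ^ k) :
    HasFPowerSeriesOnBall (fun x : ℝ => ∑' k, q k * x ^ k)
      (FormalMultilinearSeries.ofScalars ℝ q) 0 1 := by
  have hr : (1 : ℝ≥0∞) ≤ (FormalMultilinearSeries.ofScalars ℝ q).radius := by
    refine ENNReal.le_of_forall_nnreal_lt fun r hr => ?_
    refine FormalMultilinearSeries.le_radius_of_summable_norm _ ?_
    simpa [FormalMultilinearSeries.ofScalars_norm] using hq r (by exact_mod_cast hr)
  convert ((FormalMultilinearSeries.ofScalars ℝ q).hasFPowerSeriesOnBall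
    (zero_lt_one.trans_le hr)).mono zero_lt_one hr using 1
  have := FormalMultilinearSeries.ofScalarsSum_eq_tsum (E := ℝ) q
  simpa [FormalMultilinearSeries.ofScalarsSum] using this.symm

theorem analyticAt_tsum {q : ℕ → ℝ}
    (hq : ∀ r : ℝ≥0, r < 1 → Summable fun k => |q k| * (r : ℝ) ^ k) {x : ℝ} (hx : |x| < 1) :
    AnalyticAt ℝ (fun x : ℝ => ∑' k, q k * x ^ k) x := by
  refine (hasFPowerSeriesOnBall_tsum hq).analyticAt_of_mem ?_
  rw [Metric.mem_eball, edist_zero_right, ← ofReal_norm, Real.norm_eq_abs]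
  exact ENNReal.ofReal_lt_one.2 hx

theorem summable_abs_mul_pow_of_summable {q : ℕ → ℝ} (hq : Summable fun k => |q k|) (r : ℝ≥0)
    (hr : r < 1) : Summable fun k => |q k| * (r : ℝ) ^ k :=
  hq.of_nonneg_of_le (fun k => by positivity) fun k =>
    mul_le_of_le_one_right (abs_nonneg _) (pow_le_one₀ r.2 (by exact_mod_cast hr.le))

/-- Absolutely summable coefficients are determined by their generating function on an interval. -/
theorem eq_of_tsum_mul_pow_eq {q q' : ℕ → ℝ} (hq : Summable fun k => |q k|)
    (hq' : Summable fun k => |q' k|) {a : ℝ} (ha0 : 0 ≤ a) (ha : a < 1)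
    (h : ∀ z ∈ Ioo a 1, ∑' k, q k * z ^ k = ∑' k, q' k * z ^ k) : q = q' := by
  have hq1 := summable_abs_mul_pow_of_summable hq
  have hq1' := summable_abs_mul_pow_of_summable hq'
  have han : ∀ {p : ℕ → ℝ}, (∀ r : ℝ≥0, r < 1 → Summable fun k => |p k| * (r : ℝ) ^ k) →
      AnalyticOnNhd ℝ (fun x : ℝ => ∑' k, p k * x ^ k) (Ioo (-1) 1) :=
    fun hp x hx => analyticAt_tsum hp (abs_lt.2 hx)
  have hmid : (a + 1) / 2 ∈ Ioo a 1 := ⟨by linarith, by linarith⟩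
  -- Agreement is known only near `1`: for `σ > 1` the point `1 - σ + σ z` is in `[0, 1]` only for
  -- such `z`. The identity theorem moves it to a neighbourhood of `0`.
  have heq := (han hq1).eqOn_of_preconnected_of_eventuallyEq (han hq1') isPreconnected_Ioo
    (z₀ := (a + 1) / 2) ⟨by linarith, hmid.2⟩
    (Filter.eventually_of_mem (isOpen_Ioo.mem_nhds hmid) h)
  have hev := Filter.eventually_of_mem
    (isOpen_Ioo.mem_nhds (show (0 : ℝ) ∈ Ioo (-1 : ℝ) 1 by norm_num)) heq
  exact FormalMultilinearSeries.ofScalars_series_injective ℝ ℝ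
    ((hasFPowerSeriesOnBall_tsum hq1).hasFPowerSeriesAt.eq_formalMultilinearSeries_of_eventually
      (hasFPowerSeriesOnBall_tsum hq1').hasFPowerSeriesAt hev)

/-! ### Expansion of `(A - B z)^(-s) (C + D z)^n`. -/

/-- The coefficients of `(1 - x)^(-s)`. -/
noncomputable def negBinomCoeff (s : ℝ) (k : ℕ) : ℝ := Ring.choose (s + k - 1) k

theorem summable_negBinomCoeff (s : ℝ) (r : ℝ≥0) (hr : r < 1) :
    Summable fun k => |negBinomCoeff s k| * (r : ℝ) ^ k := by
  have h := Real.one_div_one_sub_rpow_hasFPowerSeriesOnBall_zero s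
  have := FormalMultilinearSeries.summable_norm_mul_pow _
    (lt_of_lt_of_le (by exact_mod_cast hr : (r : ℝ≥0∞) < 1) h.r_le)
  simpa [FormalMultilinearSeries.ofScalars_norm, negBinomCoeff] using this

theorem hasSum_negBinomCoeff (s : ℝ) {x : ℝ} (hx : |x| < 1) :
    HasSum (fun k => negBinomCoeff s k * x ^ k) ((1 - x) ^ (-s)) := by
  have h := (Real.one_div_one_sub_rpow_hasFPowerSeriesOnBall_zero s).hasSum (y := x) (by
    rw [Metric.mem_eball, edist_zero_right, ← ofReal_norm, Real.norm_eq_abs]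
    exact ENNReal.ofReal_lt_one.2 hx)
  have h1 : 0 ≤ 1 - x := by linarith [(abs_lt.1 hx).2]
  simpa [FormalMultilinearSeries.ofScalars_apply_eq, negBinomCoeff, Real.rpow_neg h1, mul_comm]
    using h

theorem hasSum_shift {g f : ℕ → ℝ} (j : ℕ) {a : ℝ} (h : HasSum (fun i => g i * f (i + j)) a) :
    HasSum (fun k => (if j ≤ k then g (k - j) else 0) * f k) a := by
  rw [← (add_left_injective j).hasSum_iff]
  · simpa [Function.comp_def] using h
  · intro k hk
    have : ¬ j ≤ k := fun hjk => hk ⟨k - j, Nat.sub_add_cancel hjk⟩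
    simp [this]

theorem summable_negBinomCoeff_mul (s : ℝ) {f : ℕ → ℝ} {K : ℝ} (hf : ∀ k, |f k| ≤ K) (j : ℕ)
    (r : ℝ≥0) (hr : r < 1) :
    Summable fun i => |negBinomCoeff s i * f (i + j)| * (r : ℝ) ^ i := by
  refine ((summable_negBinomCoeff s r hr).mul_left K).of_nonneg_of_le
    (fun i => by positivity) fun i => ?_
  rw [abs_mul]
  calc _ ≤ |negBinomCoeff s i| * K * (r : ℝ) ^ i := by gcongr; exact hf _
    _ = _ := by ring

/-- The pairing of `f` with the coefficients of `(A - B z)^(-s) (C + D z)^n`. -/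
noncomputable def coeffPairing (s : ℝ) (n : ℕ) (A B C D : ℝ) (f : ℕ → ℝ) : ℝ :=
  A ^ (-s) * ∑ j ∈ Finset.range (n + 1), n.choose j * C ^ (n - j) * D ^ j *
    ∑' i, negBinomCoeff s i * f (i + j) * (B / A) ^ i

/-- The coefficients of `(A - B z)^(-s) (C + D z)^n`. -/
noncomputable def mobiusCoeff (s : ℝ) (n : ℕ) (A B C D : ℝ) (k : ℕ) : ℝ :=
  A ^ (-s) * ∑ j ∈ Finset.range (n + 1), n.choose j * C ^ (n - j) * D ^ j *
    if j ≤ k then negBinomCoeff s (k - j) * (B / A) ^ (k - j) else 0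

theorem summable_negBinomCoeff_mul_pow (s : ℝ) {f : ℕ → ℝ} {K : ℝ} (hf : ∀ k, |f k| ≤ K) (j : ℕ)
    {x : ℝ} (hx : |x| < 1) : Summable fun i => negBinomCoeff s i * f (i + j) * x ^ i := by
  have h := summable_negBinomCoeff_mul s hf j (Real.nnabs x) (by simpa [← NNReal.coe_lt_coe])
  refine Summable.of_norm (h.congr fun i => ?_)
  rw [Real.norm_eq_abs, abs_mul _ (x ^ i), abs_pow, Real.coe_nnabs]

theorem hasSum_mobiusCoeff_mul (s : ℝ) (n : ℕ) {A B : ℝ} (C D : ℝ) (hBA : |B / A| < 1)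
    {f : ℕ → ℝ} {K : ℝ} (hf : ∀ k, |f k| ≤ K) :
    HasSum (fun k => mobiusCoeff s n A B C D k * f k) (coeffPairing s n A B C D f) := by
  have h : ∀ j, HasSum (fun k =>
      (if j ≤ k then negBinomCoeff s (k - j) * (B / A) ^ (k - j) else 0) * f k)
      (∑' i, negBinomCoeff s i * f (i + j) * (B / A) ^ i) := by
    intro j
    refine hasSum_shift (g := fun i => negBinomCoeff s i * (B / A) ^ i) j ?_
    simpa [mul_right_comm] using (summable_negBinomCoeff_mul_pow s hf j hBA).hasSum
  have h' := (hasSum_sum (s := Finset.range (n + 1)) fun j _ =>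
    (h j).mul_left (n.choose j * C ^ (n - j) * D ^ j)).mul_left (A ^ (-s))
  refine h'.congr_fun ?_
  intro k
  simp only [mobiusCoeff, mul_assoc, Finset.sum_mul]

theorem summable_abs_mobiusCoeff (s : ℝ) (n : ℕ) {A B : ℝ} (C D : ℝ) (hBA : |B / A| < 1) :
    Summable fun k => |mobiusCoeff s n A B C D k| := by
  have h := (hasSum_mobiusCoeff_mul s n C D hBA (f := fun _ => 1) (K := 1) (by simp)).summable
  simpa using h.abs

theorem coeffPairing_pow (s : ℝ) (n : ℕ) {A B : ℝ} (C D : ℝ) (hA : 0 < A) (hBA : |B / A| < 1)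
    {z : ℝ} (hz : |z| ≤ 1) :
    coeffPairing s n A B C D (fun k => z ^ k) = (A - B * z) ^ (-s) * (C + D * z) ^ n := by
  have hx : |B / A * z| < 1 := by
    rw [abs_mul]
    exact lt_of_le_of_lt (mul_le_of_le_one_right (abs_nonneg _) hz) hBA
  have h : ∀ j, ∑' i, negBinomCoeff s i * z ^ (i + j) * (B / A) ^ i =
      (1 - B / A * z) ^ (-s) * z ^ j := by
    intro j
    rw [← (hasSum_negBinomCoeff s hx).tsum_eq, ← tsum_mul_right]
    refine tsum_congr fun i => ?_
    rw [pow_add, mul_pow]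
    ring
  have h1 : 0 ≤ 1 - B / A * z := by linarith [(abs_lt.1 hx).2]
  have h2 : A - B * z = A * (1 - B / A * z) := by field_simp
  rw [coeffPairing, h2, Real.mul_rpow hA.le h1, add_comm C, add_pow, Finset.mul_sum,
    Finset.mul_sum]
  refine Finset.sum_congr rfl fun j _ => ?_
  rw [h, mul_pow]
  ring

/-- Coefficients are identified by testing on powers; only then is an arbitrary bounded `f` paired
with them. -/
theorem tsum_mul_eq_coeffPairing {s : ℝ} {n : ℕ} {A B C D : ℝ} (hA : 0 < A) (hBA : |B / A| < 1)
    {q : ℕ → ℝ} (hq : Summable fun k => |q k|) {a : ℝ} (ha0 : 0 ≤ a) (ha : a < 1)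
    (h : ∀ z ∈ Ioo a 1, ∑' k, q k * z ^ k = (A - B * z) ^ (-s) * (C + D * z) ^ n)
    {f : ℕ → ℝ} {K : ℝ} (hf : ∀ k, |f k| ≤ K) :
    ∑' k, q k * f k = coeffPairing s n A B C D f := by
  have : q = mobiusCoeff s n A B C D := by
    refine eq_of_tsum_mul_pow_eq hq (summable_abs_mobiusCoeff s n C D hBA) ha0 ha fun z hz => ?_
    have hz1 : |z| ≤ 1 := by rw [abs_of_nonneg (ha0.trans hz.1.le)]; exact hz.2.le
    rw [h z hz, ← coeffPairing_pow s n C D hA hBA hz1]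
    refine (hasSum_mobiusCoeff_mul s n C D hBA (K := 1) fun k => ?_).tsum_eq.symm
    rw [abs_pow]
    exact pow_le_one₀ (abs_nonneg _) hz1
  rw [this]
  exact (hasSum_mobiusCoeff_mul s n C D hBA hf).tsum_eq

theorem analyticAt_coeffPairing (s : ℝ) (n : ℕ) {A B C D : ℝ → ℝ} {r : ℝ} (hA : AnalyticAt ℝ A r)
    (hB : AnalyticAt ℝ B r) (hC : AnalyticAt ℝ C r) (hD : AnalyticAt ℝ D r) (hA0 : 0 < A r)
    (hBA : |B r / A r| < 1) {f : ℕ → ℝ} {K : ℝ} (hf : ∀ k, |f k| ≤ K) :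
    AnalyticAt ℝ (fun r => coeffPairing s n (A r) (B r) (C r) (D r) f) r := by
  have h1 : AnalyticAt ℝ (fun r => A r ^ (-s)) r :=
    -- The order `⊤` means analytic, not merely smooth.
    (hA.contDiffAt.rpow_const_of_ne (n := ⊤) hA0.ne').analyticAt
  refine h1.mul (Finset.analyticAt_fun_sum _ fun j _ => ?_)
  refine (((analyticAt_const.mul (hC.pow _)).mul (hD.pow _))).mul ?_
  exact AnalyticAt.fun_comp (f := fun r => B r / A r)
    (analyticAt_tsum (summable_negBinomCoeff_mul s hf j) hBA) (hB.fun_div hA hA0.ne')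

/-! ### Fubini for the binomial kernel. -/

theorem binomialKernel_eq_zero {σ : ℝ} {m k : ℕ} (h : m < k) : binomialKernel σ m k = 0 := by
  simp [binomialKernel, Nat.choose_eq_zero_of_lt h]

theorem hasSum_mul_binomialKernel (σ : ℝ) (f : ℕ → ℝ) (m : ℕ) :
    HasSum (fun k => f k * binomialKernel σ m k) (binomialOp σ f m) :=
  hasSum_sum_of_ne_finset_zero fun k hk => by
    rw [binomialKernel_eq_zero (by simpa using hk), mul_zero]

/-- Row `m` of the kernel has absolute sum `(σ + |1 - σ|) ^ m`. -/
theorem summable_prod_mul_binomialKernel {σ : ℝ} (hσ : 0 ≤ σ) {w : ℕ → ℝ}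
    (hw : Summable fun m => |w m| * (σ + |1 - σ|) ^ m) :
    Summable fun p : ℕ × ℕ => |w p.1 * binomialKernel σ p.1 p.2| := by
  have h : ∀ m, HasSum (fun k => |w m * binomialKernel σ m k|) (|w m| * (σ + |1 - σ|) ^ m) := by
    intro m
    have h1 := sum_abs_binomialKernel_mul_pow hσ 1 m
    simp only [one_pow, mul_one] at h1
    rw [← h1]
    simp only [abs_mul]
    refine HasSum.mul_left _ (hasSum_sum_of_ne_finset_zero fun k hk => ?_)
    rw [binomialKernel_eq_zero (by simpa using hk), abs_zero]
  rw [summable_prod_of_nonneg fun p => abs_nonneg _]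
  exact ⟨fun m => (h m).summable, hw.congr fun m => (h m).tsum_eq.symm⟩

theorem summable_abs_tsum_mul_binomialKernel {σ : ℝ} (hσ : 0 ≤ σ) {w : ℕ → ℝ}
    (hw : Summable fun m => |w m| * (σ + |1 - σ|) ^ m) :
    Summable fun k => |∑' m, w m * binomialKernel σ m k| := by
  have h := (summable_prod_mul_binomialKernel hσ hw).prod_symm
  refine h.prod.of_nonneg_of_le (fun k => abs_nonneg _) fun k => ?_
  have hk := h.prod_factor k
  simpa using norm_tsum_le_tsum_norm (f := fun m => w m * binomialKernel σ m k) hk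

theorem tsum_mul_binomialOp {σ : ℝ} (hσ : 0 ≤ σ) {w : ℕ → ℝ}
    (hw : Summable fun m => |w m| * (σ + |1 - σ|) ^ m) {f : ℕ → ℝ} {K : ℝ} (hf : ∀ k, |f k| ≤ K) :
    ∑' m, w m * binomialOp σ f m = ∑' k, (∑' m, w m * binomialKernel σ m k) * f k := by
  have h : Summable (Function.uncurry fun m k => w m * binomialKernel σ m k * f k) := by
    refine Summable.of_norm_bounded ((summable_prod_mul_binomialKernel hσ hw).mul_right K) ?_
    rintro ⟨m, k⟩
    simp only [Function.uncurry_apply_pair, norm_mul _ (f k), Real.norm_eq_abs]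
    gcongr
    exact hf k
  calc _ = ∑' m, ∑' k, w m * binomialKernel σ m k * f k := by
        refine tsum_congr fun m => ?_
        rw [← (hasSum_mul_binomialKernel σ f m).tsum_eq, ← tsum_mul_left]
        exact tsum_congr fun k => by ring
    _ = ∑' k, ∑' m, w m * binomialKernel σ m k * f k := h.tsum_comm.symm
    _ = _ := by simp_rw [tsum_mul_right]

/-! ### Self-similarity by analytic continuation in `r`. -/

theorem pgf_eq_div {β y t : ℝ} (h : 0 < 1 + t * (1 - y)) (n : ℕ) :
    pgf β y n t = (1 + t - t * y) ^ (-(β + n)) * (t + (1 - t) * y) ^ n := by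
  have e : 1 + t - t * y = 1 + t * (1 - y) := by ring
  have e2 : 1 - (1 - y) / (1 + t * (1 - y)) = (t + (1 - t) * y) / (1 + t * (1 - y)) := by
    rw [eq_div_iff h.ne', sub_mul, div_mul_cancel₀ _ h.ne']
    ring
  rw [pgf, e, e2, neg_add, Real.rpow_add h, Real.rpow_neg h.le (n : ℝ), Real.rpow_natCast, div_pow]
  field_simp

/-- The bound `1 - 1 / σ` is the zero of `1 - σ + σ z`. -/
theorem affine_mem_Icc {σ r z : ℝ} (hσ : 0 < σ) (hr : r ∈ Icc 0 1) (hz : max 0 (1 - 1 / σ) ≤ z)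
    (hz1 : z ≤ 1) : r * (1 - σ + σ * z) ∈ Icc 0 1 := by
  have h0 : 0 ≤ 1 - σ + σ * z := by
    have := mul_le_mul_of_nonneg_left ((le_max_right _ _).trans hz) hσ.le
    rw [mul_sub, mul_one_div_cancel hσ.ne'] at this
    linarith
  have h1 : 1 - σ + σ * z ≤ 1 := by nlinarith
  exact ⟨mul_nonneg hr.1 h0, mul_le_one₀ hr.2 h0 h1⟩

/-- The pairing of `f` with the kernel `Q_t r^· D_σ` of generating function `pgf β (r(1-σ+σz)) n t`,
in closed form. -/
noncomputable def thinnedPairing (β t σ : ℝ) (n : ℕ) (f : ℕ → ℝ) (r : ℝ) : ℝ :=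
  coeffPairing (β + n) n (1 + t - t * (r * (1 - σ))) (t * (r * σ))
    (t + (1 - t) * (r * (1 - σ))) ((1 - t) * (r * σ)) f

/-- With `A` and `B` the two quantities compared, `A - B = 1 + t (1 - r) > 0`. The strict gap
persists at `r = 1`, whence analyticity there. -/
theorem thinned_pos {t σ r : ℝ} (ht : 0 ≤ t) (hσ : 0 < σ) (hr : r ∈ Icc 0 1) :
    0 < 1 + t - t * (r * (1 - σ)) ∧ |t * (r * σ) / (1 + t - t * (r * (1 - σ)))| < 1 := by
  have h1 : 0 ≤ t * (1 - r) := mul_nonneg ht (by linarith [hr.2])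
  have h2 : 0 ≤ t * (r * σ) := mul_nonneg ht (mul_nonneg hr.1 hσ.le)
  have h3 : 0 < 1 + t - t * (r * (1 - σ)) := by nlinarith
  refine ⟨h3, ?_⟩
  rw [abs_of_nonneg (div_nonneg h2 h3.le), div_lt_one h3]
  nlinarith

theorem analyticAt_thinnedPairing {β t σ r : ℝ} (ht : 0 ≤ t) (hσ : 0 < σ) (hr : r ∈ Icc 0 1)
    (n : ℕ) {f : ℕ → ℝ} {K : ℝ} (hf : ∀ k, |f k| ≤ K) :
    AnalyticAt ℝ (thinnedPairing β t σ n f) r := by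
  have h := thinned_pos ht hσ hr
  exact analyticAt_coeffPairing (A := fun r => 1 + t - t * (r * (1 - σ)))
    (B := fun r => t * (r * σ)) (C := fun r => t + (1 - t) * (r * (1 - σ)))
    (D := fun r => (1 - t) * (r * σ)) _ _ (by fun_prop) (by fun_prop) (by fun_prop) (by fun_prop)
    h.1 h.2 hf

theorem tsum_mul_eq_thinnedPairing {β t σ r : ℝ} (ht : 0 ≤ t) (hσ : 0 < σ) (hr : r ∈ Icc 0 1)
    {n : ℕ} {q : ℕ → ℝ} (hq : Summable fun k => |q k|)
    (h : ∀ z, max 0 (1 - 1 / σ) < z → z < 1 →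
      ∑' k, q k * z ^ k = pgf β (r * (1 - σ + σ * z)) n t)
    {f : ℕ → ℝ} {K : ℝ} (hf : ∀ k, |f k| ≤ K) :
    ∑' k, q k * f k = thinnedPairing β t σ n f r := by
  have h0 := thinned_pos ht hσ hr
  refine tsum_mul_eq_coeffPairing h0.1 h0.2 hq (a := max 0 (1 - 1 / σ)) (le_max_left _ _)
    (max_lt one_pos (by simpa using hσ)) (fun z hz => ?_) hf
  have hy := affine_mem_Icc hσ hr hz.1.le hz.2.le
  rw [h z hz.1 hz.2, pgf_eq_div (by nlinarith [hy.2])]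
  congr 2 <;> ring

/-- The factor `r ^ m` offsets the growth `(σ + |1 - σ|) ^ m` of the row sums, so Fubini is
legitimate. -/
theorem tsum_transProb_mul_pow_mul_binomialOp {β t σ r : ℝ} (hβ : 0 ≤ β) (ht : 0 ≤ t) (hσ : 0 < σ)
    (hr : r ∈ Icc 0 1) (hrσ : r * (σ + |1 - σ|) ≤ 1) (n : ℕ) {f : ℕ → ℝ} {K : ℝ}
    (hf : ∀ k, |f k| ≤ K) :
    ∑' m, (transProb (rate β) t n m).toReal * r ^ m * binomialOp σ f m =
      thinnedPairing β t σ n f r := by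
  have hw : Summable fun m => |(transProb (rate β) t n m).toReal * r ^ m| * (σ + |1 - σ|) ^ m := by
    refine (summable_transProb hβ ht n).of_nonneg_of_le (fun m => by positivity) fun m => ?_
    have h0 : 0 ≤ r * (σ + |1 - σ|) := mul_nonneg hr.1 (by positivity)
    rw [abs_of_nonneg (mul_nonneg ENNReal.toReal_nonneg (pow_nonneg hr.1 m)), mul_assoc, ← mul_pow]
    exact mul_le_of_le_one_right ENNReal.toReal_nonneg (pow_le_one₀ h0 hrσ)
  rw [tsum_mul_binomialOp hσ.le hw hf]
  refine tsum_mul_eq_thinnedPairing ht hσ hr (summable_abs_tsum_mul_binomialKernel hσ.le hw)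
    (fun z hz hz1 => ?_) hf
  have hz0 : 0 ≤ z := (le_max_left _ _).trans hz.le
  have hy := affine_mem_Icc hσ hr hz.le hz1.le
  rw [← tsum_mul_binomialOp (K := 1) hσ.le hw,
    ← (hasSum_transProb_mul_pow hβ hy.1 hy.2 ht n).tsum_eq]
  · refine tsum_congr fun m => ?_
    rw [mul_pow, ← sum_binomialKernel_mul_pow, binomialOp, mul_assoc]
    simp_rw [mul_comm (z ^ _)]
  · intro k
    rw [abs_of_nonneg (by positivity)]
    exact pow_le_one₀ hz0 hz1.le

/-- With `y = 1 - σ + σ z` one has `t (1 - y) = σ t (1 - z)`, so the prefactors agree and the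
binomial theorem does the rest. -/
theorem sum_binomialKernel_mul_pgf {β t σ z : ℝ} (h : 0 < 1 + σ * t * (1 - z)) (n : ℕ) :
    ∑ l ∈ Finset.range (n + 1), binomialKernel σ n l * pgf β z l (σ * t) =
      pgf β (1 - σ + σ * z) n t := by
  have e : 1 + t * (1 - (1 - σ + σ * z)) = 1 + σ * t * (1 - z) := by ring
  have e2 : 1 - (1 - (1 - σ + σ * z)) / (1 + σ * t * (1 - z)) =
      1 - σ + σ * (1 - (1 - z) / (1 + σ * t * (1 - z))) := by
    field_simp
    ring
  rw [pgf, e, e2, ← sum_binomialKernel_mul_pow, Finset.mul_sum]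
  refine Finset.sum_congr rfl fun l _ => ?_
  rw [pgf]
  ring

/-- Here the sum over `l` is finite, so no regularisation is needed and `r = 1` is reached directly.
-/
theorem binomialOp_semigroup {β t σ : ℝ} (hβ : 0 ≤ β) (ht : 0 ≤ t) (hσ : 0 < σ) (n : ℕ)
    {f : ℕ → ℝ} {K : ℝ} (hf : ∀ k, |f k| ≤ K) :
    binomialOp σ (semigroup β (σ * t) f) n = thinnedPairing β t σ n f 1 := by
  have hσt : 0 ≤ σ * t := by positivity
  have hsum : ∀ {g : ℕ → ℝ} {a : ℕ → ℝ},
      (∀ l, HasSum (fun k => (transProb (rate β) (σ * t) l k).toReal * g k) (a l)) →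
      HasSum (fun k => (∑ l ∈ Finset.range (n + 1),
        binomialKernel σ n l * (transProb (rate β) (σ * t) l k).toReal) * g k)
        (∑ l ∈ Finset.range (n + 1), binomialKernel σ n l * a l) := by
    intro g a h
    refine (hasSum_sum fun l _ => (h l).mul_left (binomialKernel σ n l)).congr_fun fun k => ?_
    rw [Finset.sum_mul]
    exact Finset.sum_congr rfl fun l _ => mul_assoc _ _ _
  have hs : ∀ l, HasSum (fun k => (transProb (rate β) (σ * t) l k).toReal * f k)
      (semigroup β (σ * t) f l) := by
    intro l
    rw [semigroup_eq_tsum hβ hσt]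
    refine (Summable.of_norm ?_).hasSum
    simpa [abs_mul] using summable_transProb_mul_of_bounded hβ hσt l hf
  have hq : Summable fun k => |∑ l ∈ Finset.range (n + 1),
      binomialKernel σ n l * (transProb (rate β) (σ * t) l k).toReal| := by
    have := (hsum (g := fun _ => 1)
      (fun l => by simpa using (summable_transProb hβ hσt l).hasSum)).summable
    simpa using this.abs
  rw [← tsum_mul_eq_thinnedPairing ht hσ ⟨zero_le_one, le_rfl⟩ hq (fun z hz hz1 => ?_) hf,
    (hsum hs).tsum_eq, binomialOp]
  · simp_rw [mul_comm (semigroup _ _ _ _)]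
  · have hz0 : 0 ≤ z := (le_max_left _ _).trans hz.le
    rw [(hsum fun l => hasSum_transProb_mul_pow hβ hz0 hz1.le hσt l).tsum_eq, one_mul,
      sum_binomialKernel_mul_pgf]
    nlinarith

/-- Self-similarity of the semigroup under the signed binomial kernel. -/
theorem semigroup_binomialOp {β t σ : ℝ} (hβ : 0 ≤ β) (ht : 0 ≤ t) (hσ : 0 < σ) (n : ℕ)
    {f : ℕ → ℝ} {K : ℝ} (hf : ∀ k, |f k| ≤ K) (hint : Integrable (binomialOp σ f) (law β t n)) :
    semigroup β t (binomialOp σ f) n = binomialOp σ (semigroup β (σ * t) f) n := by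
  rw [integrable_law_iff hβ ht] at hint
  have hq : Summable fun m => |(transProb (rate β) t n m).toReal * binomialOp σ f m| := by
    simpa [abs_mul] using hint
  set Φ : ℝ → ℝ := fun r => ∑' m, (transProb (rate β) t n m).toReal * binomialOp σ f m * r ^ m
    with hΦ
  have hpos : 0 < σ + |1 - σ| := by positivity
  have hlow : 1 ≤ σ + |1 - σ| := by linarith [le_abs_self (1 - σ)]
  have hinv : (σ + |1 - σ|)⁻¹ ≤ 1 := inv_le_one_of_one_le₀ hlow
  have hinv0 : 0 < (σ + |1 - σ|)⁻¹ := inv_pos.2 hpos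
  have hsmall : ∀ r ∈ Ioo 0 (σ + |1 - σ|)⁻¹, Φ r = thinnedPairing β t σ n f r := by
    intro r hr
    have hrσ : r * (σ + |1 - σ|) ≤ 1 := by
      have := mul_le_mul_of_nonneg_right hr.2.le hpos.le
      rwa [inv_mul_cancel₀ hpos.ne'] at this
    rw [← tsum_transProb_mul_pow_mul_binomialOp hβ ht hσ ⟨hr.1.le, hr.2.le.trans hinv⟩ hrσ n hf]
    exact tsum_congr fun m => by ring
  have hΦa : AnalyticOnNhd ℝ Φ (Ioo 0 1) := fun r hr =>
    analyticAt_tsum (summable_abs_mul_pow_of_summable hq)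
      (abs_lt.2 ⟨by linarith [hr.1], hr.2⟩)
  have hmid : (σ + |1 - σ|)⁻¹ / 2 ∈ Ioo 0 (σ + |1 - σ|)⁻¹ := ⟨by linarith, by linarith⟩
  have heq : EqOn Φ (thinnedPairing β t σ n f) (Ioo 0 1) :=
    hΦa.eqOn_of_preconnected_of_eventuallyEq
      (fun r hr => analyticAt_thinnedPairing ht hσ (Ioo_subset_Icc_self hr) n hf)
      isPreconnected_Ioo ⟨hmid.1, hmid.2.trans_le hinv⟩
      (Filter.eventually_of_mem (isOpen_Ioo.mem_nhds hmid) hsmall)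
  -- Abel's theorem in its easy form: absolute summability at `r = 1` gives uniform convergence.
  -- This is where `hint` is essential.
  have hΦc : ContinuousOn Φ (Icc 0 1) := by
    refine continuousOn_tsum (fun m => by fun_prop) hq fun m r hr => ?_
    rw [norm_mul, Real.norm_eq_abs, norm_pow, Real.norm_of_nonneg hr.1]
    exact mul_le_of_le_one_right (abs_nonneg _) (pow_le_one₀ hr.1 hr.2)
  have h1 : (1 : ℝ) ∈ Icc (0 : ℝ) 1 := ⟨zero_le_one, le_rfl⟩
  have hΨc : ContinuousOn (thinnedPairing β t σ n f) (Icc 0 1) := fun r hr =>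
    (analyticAt_thinnedPairing ht hσ hr n hf).continuousAt.continuousWithinAt
  have hfin := heq.of_subset_closure hΦc hΨc Ioo_subset_Icc_self
    (closure_Ioo (zero_ne_one' ℝ)).ge h1
  rw [binomialOp_semigroup hβ ht hσ n hf, ← hfin, semigroup_eq_tsum hβ ht]
  simp [hΦ]

end BirthDeath

theorem proposition1 (β : ℝ) (hβ : 0 ≤ β) (σ : ℝ≥0) (hσ : 0 < σ) :
    -- `d_σ Λ = Λ D_σ` on bounded functions, all integrals being absolutely convergent
    (∀ f : ℕ → ℝ, (∃ C : ℝ, ∀ n, |f n| ≤ C) → ∀ x : ℝ≥0,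
      Integrable f (poissonMeasure (σ * x)) ∧
      Integrable (BirthDeath.binomialOp σ f) (poissonMeasure x) ∧
      BirthDeath.dilation σ (BirthDeath.poissonOp f) x =
        BirthDeath.poissonOp (BirthDeath.binomialOp σ f) x) ∧
    -- `Q_t D_σ = D_σ Q_{σ t}` on the bounded functions for which the left side is defined
    (∀ t : ℝ, 0 < t → ∀ f : ℕ → ℝ, (∃ C : ℝ, ∀ n, |f n| ≤ C) →
      (∀ n, Integrable f (BirthDeath.law β (σ * t) n)) ∧
      (∀ n, Integrable (BirthDeath.binomialOp σ f) (BirthDeath.law β t n) →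
        BirthDeath.semigroup β t (BirthDeath.binomialOp σ f) n =
          BirthDeath.binomialOp σ (BirthDeath.semigroup β (σ * t) f) n)) ∧
    -- the left side is defined for all bounded `f` if `σ ≤ 1`, and more generally:
    (∀ t : ℝ, 0 < t → ∀ (f : ℕ → ℝ) (C ρ : ℝ), 0 ≤ ρ → ρ ≤ 1 → (∀ n, |f n| ≤ C * ρ ^ n) →
      (σ * ρ + |1 - (σ : ℝ)|) * t < 1 + t →
      ∀ n, Integrable (BirthDeath.binomialOp σ f) (BirthDeath.law β t n)) := by
  refine ⟨fun f ⟨C, hC⟩ x => ⟨BirthDeath.integrable_poissonMeasure_of_bounded hC _,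
    BirthDeath.integrable_binomialOp_poissonMeasure σ.2 hC x,
    BirthDeath.dilation_poissonOp σ hC x⟩, fun t ht f ⟨C, hC⟩ => ⟨fun n => ?_, fun n hint => ?_⟩,
    fun t ht f C ρ hρ _ hf h n => ?_⟩
  · have hσt : 0 ≤ (σ : ℝ) * t := by positivity
    rw [BirthDeath.integrable_law_iff hβ hσt]
    exact BirthDeath.summable_transProb_mul_of_bounded hβ hσt n hC
  · exact BirthDeath.semigroup_binomialOp hβ ht.le hσ n hC hint
  · exact BirthDeath.integrable_binomialOp_law hβ ht.le σ.2 hρ hf h n
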